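/- Let $(V,E)$ be a finite directed acyclic graph with at least two nodes and a source $r\in V$, and let link $e\in E$ have capacity $c_e\in\{0,1,2,\dots\}$ packets per slot. Let $\Xi$ be a finite set of network configurations. Each $\sigma\in\Xi$ has a set $E_\sigma\subseteq E$ of links that are ON and a nonempty set $\mathcal M_\sigma\subseteq\{0,1\}^{E}$ of feasible link activations, all of them zero outside $E_\sigma$. The configuration process $(\sigma(t))_t$ in slotted time is stationary and ergodic, and $p(\sigma)=\mathbb P(\sigma(t)=\sigma)$. For each rate $\lambda\ge 0$, the numbers $A(t)\in\{0,1,2,\dots\}$ of packets arriving at $r$ in slot $t$ are i.i.d. over slots with mean $\lambda$. No assumption is made on the joint law of the arrivals and the configurations. In each slot $t$ a policy chooses an activation $s(t)\in\mathcal M_{\sigma(t)}$ and sends over each link $e=(i,j)$ a set of at most $c_e s_e(t)$ packets that node $i$ has received before slot $t$. Its decisions may be arbitrary random variables; in particular, they may use the whole past and future of the processes. Let $R_i(T)$ be the number of distinct packets received by node $i$ up to time $T$ (for $i=r$ these include the packets that have arrived at $r$). When the arrival rate is $\lambda$, the policy is a broadcast policy of rate $\lambda$ if $\min_{i\in V}\liminf_{T\to\infty}R_i(T)/T=\lambda$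 with probability one. The broadcast capacity $\lambda^*$ is the supremum of all arrival rates $\lambda\ge0$ for which there is a broadcast policy of rate $\lambda$. For $U\subseteq V$, let $u_U\in\mathbb R^E$ have entry $c_{(i,j)}$ at each link $(i,j)$ with $i\in U$, $j\notin U$, and entry $0$ at all other links, and put $u_j=u_{V\setminus\{j\}}$. Then $\lambda^*$ is finite, $$\lambda^*=\max_{\beta_\sigma\in\mathrm{conv}(\mathcal M_\sigma),\ \sigma\in\Xi}\ \ \min_{j\in V\setminus\{r\}}\ u_j\cdot\Big(\sum_{\sigma\in\Xi}p(\sigma)\beta_\sigma\Big),$$ where the maximum is attained, and the value is the same when the minimum is taken over all proper cuts, that is, over all $u_U$ with $r\in U\subsetneq V$; so only the single-node cuts matter. -/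

import Mathlib

open MeasureTheory ProbabilityTheory Filter

/-- A time-varying wireless network with node set `V` and (finite) set of configurations `Xi`.
Links are point-to-point and directed: `(i, j) ∈ E` is a link from `i` to `j`. The capacity of a
link is a number of packets per slot. The interference model enters through the sets `M σ` of
feasible link activations in each configuration `σ`, which are 0/1 incidence vectors. -/
structure WirelessNetwork (V Xi : Type*) where
  /-- the directed links -/
  E : Finset (V × V)
  /-- the source node -/
  source : V
  /-- link capacities, in packets per slot -/
  c : E → ℕ
  /-- the links that are ON in a configuration -/
  on : Xi → Set E
  /-- the feasible link-activation vectors in a configuration -/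
  M : Xi → Set (E → ℝ)
  M_nonempty : ∀ σ, (M σ).Nonempty
  M_binary : ∀ σ, ∀ s ∈ M σ, ∀ e, s e = 0 ∨ s e = 1
  M_on : ∀ σ, ∀ s ∈ M σ, ∀ e, e ∉ on σ → s e = 0

namespace WirelessNetwork

variable {V Xi : Type*}

/-- The underlying directed graph has no directed cycle. -/
def IsDAG (N : WirelessNetwork V Xi) : Prop :=
  ∀ v, ¬ Relation.TransGen (fun i j => (i, j) ∈ N.E) v v

section Cuts

variable [DecidableEq V]

/-- The cut vector of a set `U` of nodes: `c e` on the links from `U` to its complement,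
zero on all other links. -/
def cutVector (N : WirelessNetwork V Xi) (U : Finset V) : N.E → ℝ :=
  fun e => if e.1.1 ∈ U ∧ e.1.2 ∉ U then (N.c e : ℝ) else 0

/-- `U` is the source side of a proper partition of the node set. -/
def IsProperCut [Fintype V] (N : WirelessNetwork V Xi) (U : Finset V) : Prop :=
  N.source ∈ U ∧ U ≠ Finset.univ

/-- The cut vector `u_j` of the single-node cut `V \ {j}`. -/
def nodeCutVector [Fintype V] (N : WirelessNetwork V Xi) (j : V) : N.E → ℝ :=
  N.cutVector (Finset.univ.erase j)

end Cuts

end WirelessNetwork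

/-- The random process `conf` is stationary and ergodic: its law on the space of sequences is
invariant and ergodic under the shift. -/
def IsStationaryErgodic {Xi Ω : Type*} [MeasurableSpace Xi] [MeasurableSpace Ω]
    (P : Measure Ω) (conf : ℕ → Ω → Xi) : Prop :=
  (∀ t, Measurable (conf t)) ∧
    Ergodic (fun (x : ℕ → Xi) (t : ℕ) => x (t + 1)) (P.map (fun ω t => conf t ω))

/-- The number `A t` of packets arriving at the source in slot `t` is i.i.d. over slots,
with finite mean `lam`. -/
def IsArrivalProcess {Ω : Type*} [MeasurableSpace Ω]
    (P : Measure Ω) (A : ℕ → Ω → ℕ) (lam : ℝ) : Prop :=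
  (∀ t, Measurable (A t)) ∧ iIndepFun A P ∧ (∀ t, IdentDistrib (A t) (A 0) P P) ∧
    Integrable (fun ω => (A 0 ω : ℝ)) P ∧ ∫ ω, (A 0 ω : ℝ) ∂P = lam

namespace WirelessNetwork

variable {V Xi Ω : Type*}

/-- The set of packets that node `i` has received by the beginning of slot `t`, when `a t` packets
arrive at the source in slot `t` and the set `f t e` of packets is sent over the link `e` in
slot `t`. Packets are numbered `0, 1, 2, …` in their order of arrival at the source. -/
def held [DecidableEq V] (N : WirelessNetwork V Xi) (a : ℕ → ℕ) (f : ℕ → N.E → Finset ℕ) :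
    ℕ → V → Finset ℕ
  | 0, _ => ∅
  | t + 1, i => held N a f t i
      ∪ (if i = N.source then Finset.range (∑ s ∈ Finset.range (t + 1), a s) else ∅)
      ∪ (Finset.univ.filter (fun e : N.E => e.1.2 = i)).biUnion (f t)

/-- A scheduling policy for the configuration process `conf` and the arrival process `A`: in each
slot it activates a feasible set of links, and sends over each activated link a set of packets
held by the tail of that link, subject to the capacity of the link. All decisions are arbitrary
random variables, so that they may depend on the whole past and future of the processes. -/
structure Policy [DecidableEq V] [MeasurableSpace Ω] (N : WirelessNetwork V Xi)
    (conf : ℕ → Ω → Xi) (A : ℕ → Ω → ℕ) where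
  /-- the link activation vector chosen in a slot -/
  act : ℕ → Ω → N.E → ℝ
  /-- the set of packets sent over a link in a slot -/
  fwd : ℕ → Ω → N.E → Finset ℕ
  act_mem : ∀ t ω, act t ω ∈ N.M (conf t ω)
  fwd_held : ∀ t ω (e : N.E), fwd t ω e ⊆ N.held (fun s => A s ω) (fun s => fwd s ω) t e.1.1
  fwd_card : ∀ t ω (e : N.E), ((fwd t ω e).card : ℝ) ≤ N.c e * act t ω e
  act_measurable : ∀ t, Measurable (act t)
  fwd_measurable : ∀ t e k, MeasurableSet {ω | k ∈ fwd t ω e}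

section

variable [DecidableEq V] [MeasurableSpace Ω] {N : WirelessNetwork V Xi}
  {conf : ℕ → Ω → Xi} {A : ℕ → Ω → ℕ}

/-- `R_i(T)`: the number of distinct packets received by node `i` up to time `T`. -/
def Policy.received (π : N.Policy conf A) (T : ℕ) (ω : Ω) (i : V) : ℕ :=
  (N.held (fun s => A s ω) (fun s => π.fwd s ω) T i).card

/-- With probability one, `min_i liminf_T R_i(T) / T = lam`. -/
def Policy.IsBroadcastPolicy (π : N.Policy conf A) (P : Measure Ω) (lam : ℝ) : Prop :=
  ∀ᵐ ω ∂P,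
    ⨅ i : V, liminf (fun T : ℕ => (((π.received T ω i : ℝ) / (T : ℝ) : ℝ) : EReal)) atTop
      = (lam : EReal)

end

/-- `C` is the broadcast capacity: the supremum of all arrival rates `lam ≥ 0` for which there is
a broadcast policy of rate `lam`, where `A lam` is the arrival process of rate `lam`. -/
def IsBroadcastCapacity [DecidableEq V] [MeasurableSpace Ω] (N : WirelessNetwork V Xi)
    (P : Measure Ω) (conf : ℕ → Ω → Xi) (A : ℝ → ℕ → Ω → ℕ) (C : ℝ) : Prop :=
  IsLUB {lam : ℝ | 0 ≤ lam ∧ ∃ π : N.Policy conf (A lam), π.IsBroadcastPolicy P lam} C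

/-- `∑_σ p(σ) β_σ`, where `p` is the stationary distribution of the configuration process. -/
noncomputable def averageActivation [Fintype Xi] [MeasurableSpace Ω] (N : WirelessNetwork V Xi)
    (P : Measure Ω) (conf : ℕ → Ω → Xi) (β : Xi → N.E → ℝ) : N.E → ℝ :=
  ∑ σ, P.real {ω | conf 0 ω = σ} • β σ

end WirelessNetwork

/-! The proof works one sample path at a time, so neither knowledge of the future nor the joint law
of arrivals and configurations matters. Almost surely every configuration `σ` has frequency `p(σ)`
(Birkhoff's theorem) and arrivals have rate `lam` (strong law).

Upper bound (`IsDAG.exists_le_nodeCutVector_dotProduct`): a node `j` other than the source gains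
packets only over its incoming links, so `R_j(T)` is at most `u_j` applied to the sum of the
activations. Grouped by configuration, their time average is a combination of points of the convex
hulls weighted by visit frequencies. By compactness a subsequence converges to some `β`, which
bounds the rate at all nodes simultaneously.

Achievability (`IsDAG.exists_isBroadcastPolicy`): for a maximizing `β`, each configuration runs
through a fixed sequence of feasible activations with averages tending to `β σ`. Under in-order
delivery a node is a queue that follows its slowest in-neighbor, and `eventually_rate_le_of_service`
carries the rate along the links by well-founded induction. Equality of load and service is allowed,
so the supremum is itself a broadcast rate.

Cuts (`IsDAG.exists_nodeCutVector_dotProduct_le`): by acyclicity some node outside `U` has all its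
in-neighbors in `U`, and its single-node cut is no larger than the cut of `U`. -/

/-! ### Maximal inequality and Birkhoff's ergodic theorem -/

/-- The running maximum `max_{k ≤ n} S_k` of the Birkhoff sums of `g`, where `S_0 = 0`. -/
noncomputable def birkhoffMax {α : Type*} (T : α → α) (g : α → ℝ) : ℕ → α → ℝ
  | 0, _ => 0
  | n + 1, x => max 0 (g x + birkhoffMax T g n (T x))

section Birkhoff

variable {α : Type*} {T : α → α} {g : α → ℝ}

theorem birkhoffMax_nonneg (n : ℕ) (x : α) : 0 ≤ birkhoffMax T g n x := by
  cases n with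
  | zero => exact le_rfl
  | succ n => exact le_max_left _ _

theorem birkhoffMax_le_succ (n : ℕ) (x : α) :
    birkhoffMax T g n x ≤ birkhoffMax T g (n + 1) x := by
  induction n generalizing x with
  | zero => exact birkhoffMax_nonneg _ _
  | succ n ih => exact max_le_max le_rfl (add_le_add le_rfl (ih _))

theorem birkhoffSum_le_birkhoffMax (n : ℕ) (x : α) :
    birkhoffSum T g n x ≤ birkhoffMax T g n x := by
  induction n generalizing x with
  | zero => simp [birkhoffMax]
  | succ n ih =>
    rw [birkhoffSum_succ']
    exact le_max_of_le_right (add_le_add le_rfl (ih _))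

variable [MeasurableSpace α] {μ : Measure α}

theorem measurable_birkhoffMax (hT : Measurable T) (hg : Measurable g) (n : ℕ) :
    Measurable (birkhoffMax T g n) := by
  induction n with
  | zero => exact measurable_const
  | succ n ih => exact measurable_const.max (hg.add (ih.comp hT))

theorem integrable_birkhoffMax [IsFiniteMeasure μ] (hT : MeasurePreserving T μ μ)
    (hg : Integrable g μ) (n : ℕ) : Integrable (birkhoffMax T g n) μ := by
  induction n with
  | zero => exact integrable_const (0 : ℝ)
  | succ n ih =>
    exact (integrable_const (0 : ℝ)).sup (hg.add (hT.integrable_comp_of_integrable ih))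

/-- The maximal ergodic theorem. -/
theorem setIntegral_birkhoffMax_pos_nonneg [IsFiniteMeasure μ] (hT : MeasurePreserving T μ μ)
    (hgm : Measurable g) (hg : Integrable g μ) (n : ℕ) :
    0 ≤ ∫ x in {x | 0 < birkhoffMax T g n x}, g x ∂μ := by
  cases n with
  | zero => simp [birkhoffMax]
  | succ n =>
    have hmeas := measurable_birkhoffMax hT.measurable hgm (n + 1)
    have hset : MeasurableSet {x | 0 < birkhoffMax T g (n + 1) x} :=
      measurableSet_lt measurable_const hmeas
    have hi := integrable_birkhoffMax hT hg n
    have hi1 := integrable_birkhoffMax hT hg (n + 1)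
    have hiT : Integrable (fun x => birkhoffMax T g n (T x)) μ :=
      hT.integrable_comp_of_integrable hi
    have hcomp : ∫ x, birkhoffMax T g n (T x) ∂μ = ∫ x, birkhoffMax T g n x ∂μ := by
      have h := integral_map (μ := μ) hT.measurable.aemeasurable
        (f := birkhoffMax T g n) (by rw [hT.map_eq]; exact hi.aestronglyMeasurable)
      rw [hT.map_eq] at h
      exact h.symm
    have hmono : ∫ x, birkhoffMax T g n x ∂μ ≤ ∫ x, birkhoffMax T g (n + 1) x ∂μ :=
      integral_mono hi hi1 (birkhoffMax_le_succ n)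
    rw [← integral_indicator hset]
    -- Where the maximum `M_{n+1}` is positive it equals `g + M_n ∘ T`; elsewhere it is `0 ≤ M_n ∘
    -- T`. Invariance of the measure makes the integral of `M_{n+1} - M_n ∘ T` nonnegative.
    calc (0 : ℝ) ≤ ∫ x, birkhoffMax T g (n + 1) x - birkhoffMax T g n (T x) ∂μ := by
          rw [integral_sub hi1 hiT, hcomp]
          exact sub_nonneg.2 hmono
      _ ≤ _ := by
          refine integral_mono (hi1.sub hiT) (hg.indicator hset) fun x => ?_
          by_cases hx : 0 < birkhoffMax T g (n + 1) x
          · rw [Set.indicator_of_mem (by exact hx)]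
            have h1 : birkhoffMax T g (n + 1) x = max 0 (g x + birkhoffMax T g n (T x)) := rfl
            rw [h1] at hx ⊢
            rcases lt_max_iff.1 hx with h | h
            · exact absurd h (lt_irrefl _)
            · rw [max_eq_right h.le]
              simp
          · rw [Set.indicator_of_notMem (by exact hx)]
            have := birkhoffMax_nonneg (T := T) (g := g) n (T x)
            linarith

/-- For an ergodic map, the Birkhoff sums of a function of negative mean are almost surely
bounded above. -/
theorem Ergodic.ae_bddAbove_birkhoffSum [IsProbabilityMeasure μ] (hT : Ergodic T μ)
    (hgm : Measurable g) (hg : Integrable g μ) (hneg : ∫ x, g x ∂μ < 0) :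
    ∀ᵐ x ∂μ, ∃ K : ℝ, ∀ n, birkhoffSum T g n x ≤ K := by
  set B : Set α := {x | ∃ K : ℕ, ∀ n, birkhoffSum T g n x ≤ K} with hB
  have hSm : ∀ n, Measurable (birkhoffSum T g n) := fun n =>
    Finset.measurable_fun_sum _ fun k _ => hgm.comp (hT.measurable.iterate k)
  have hBm : MeasurableSet B := by
    have : B = ⋃ K : ℕ, ⋂ n : ℕ, {x | birkhoffSum T g n x ≤ K} := by
      ext x; simp [hB]
    rw [this]
    exact MeasurableSet.iUnion fun K => MeasurableSet.iInter fun n =>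
      measurableSet_le (hSm n) measurable_const
  have hinv : T ⁻¹' B = B := by
    ext x
    constructor
    · rintro ⟨K, hK⟩
      obtain ⟨K', hK'⟩ := exists_nat_ge (max 0 (g x + K))
      refine ⟨K', fun n => ?_⟩
      cases n with
      | zero => simp
      | succ n =>
        rw [birkhoffSum_succ']
        exact (add_le_add le_rfl (hK n)).trans ((le_max_right _ _).trans hK')
    · rintro ⟨K, hK⟩
      obtain ⟨K', hK'⟩ := exists_nat_ge (K - g x)
      refine ⟨K', fun n => ?_⟩
      have := hK (n + 1)
      rw [birkhoffSum_succ'] at this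
      linarith
  rcases hT.toPreErgodic.ae_mem_or_ae_notMem hBm hinv with h | h
  · filter_upwards [h] with x ⟨K, hK⟩ using ⟨K, hK⟩
  -- If the sums are almost surely unbounded above, the sets where the running maximum is positive
  -- increase to a set of full measure, and the maximal ergodic theorem gives a nonnegative mean in
  -- the limit.
  · exfalso
    have hpos : ∀ᵐ x ∂μ, x ∈ ⋃ n, {x | 0 < birkhoffMax T g n x} := by
      filter_upwards [h] with x hx
      simp only [hB, Set.mem_ofPred_eq, not_exists, not_forall, not_le] at hx
      obtain ⟨n, hn⟩ := hx 0
      exact Set.mem_iUnion.2 ⟨n, lt_of_lt_of_le (by simpa using hn)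
        (birkhoffSum_le_birkhoffMax n x)⟩
    have hlim := tendsto_setIntegral_of_monotone (μ := μ) (f := g)
      (s := fun n => {x | 0 < birkhoffMax T g n x})
      (fun n => measurableSet_lt measurable_const (measurable_birkhoffMax hT.measurable hgm n))
      (monotone_nat_of_le_succ fun n x hx => lt_of_lt_of_le hx (birkhoffMax_le_succ n x))
      hg.integrableOn
    have h0 := ge_of_tendsto' hlim
      (setIntegral_birkhoffMax_pos_nonneg hT.toMeasurePreserving hgm hg)
    rw [setIntegral_eq_integral_of_ae_compl_eq_zero] at h0
    · linarith
    · filter_upwards [hpos] with x hx hx' using absurd hx hx'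

/-- The upper half of Birkhoff's pointwise ergodic theorem. -/
theorem Ergodic.ae_eventually_birkhoffAverage_lt [IsProbabilityMeasure μ] (hT : Ergodic T μ)
    (hgm : Measurable g) (hg : Integrable g μ) {c : ℝ} (hc : ∫ x, g x ∂μ < c) :
    ∀ᵐ x ∂μ, ∀ᶠ n : ℕ in atTop, birkhoffAverage ℝ T g n x < c := by
  obtain ⟨d, hd, hdc⟩ := exists_between hc
  have h := hT.ae_bddAbove_birkhoffSum (g := fun x => g x - d) (hgm.sub_const d)
    (hg.sub (integrable_const d)) (by
      rw [integral_sub hg (integrable_const d)]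
      simpa using hd)
  filter_upwards [h] with x ⟨K, hK⟩
  obtain ⟨m, hm⟩ := exists_nat_gt (max 0 (K / (c - d)))
  filter_upwards [eventually_ge_atTop m] with n hn
  have hnm : (m : ℝ) ≤ n := by exact_mod_cast hn
  have hn0 : (0 : ℝ) < n := lt_of_lt_of_le ((le_max_left _ _).trans_lt hm) hnm
  have hKn : K < n * (c - d) := by
    rw [← div_lt_iff₀ (sub_pos.2 hdc)]
    exact ((le_max_right _ _).trans_lt hm).trans_le hnm
  have hS := hK n
  simp only [birkhoffSum, Finset.sum_sub_distrib, Finset.sum_const, Finset.card_range,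
    nsmul_eq_mul] at hS
  simp only [birkhoffAverage, birkhoffSum, smul_eq_mul]
  rw [inv_mul_lt_iff₀ hn0]
  linarith

/-- Birkhoff's pointwise ergodic theorem for an ergodic map. -/
theorem Ergodic.ae_tendsto_birkhoffAverage [IsProbabilityMeasure μ] (hT : Ergodic T μ)
    (hgm : Measurable g) (hg : Integrable g μ) :
    ∀ᵐ x ∂μ, Tendsto (fun n => birkhoffAverage ℝ T g n x) atTop (nhds (∫ x, g x ∂μ)) := by
  have hpos : ∀ m : ℕ, (0 : ℝ) < 1 / ((m : ℝ) + 1) := fun m => Nat.one_div_pos_of_nat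
  have hup : ∀ᵐ x ∂μ, ∀ m : ℕ, ∀ᶠ n : ℕ in atTop,
      birkhoffAverage ℝ T g n x < ∫ x, g x ∂μ + 1 / ((m : ℝ) + 1) :=
    ae_all_iff.2 fun m => hT.ae_eventually_birkhoffAverage_lt hgm hg (by linarith [hpos m])
  have hlow : ∀ᵐ x ∂μ, ∀ m : ℕ, ∀ᶠ n : ℕ in atTop,
      birkhoffAverage ℝ T (-g) n x < -∫ x, g x ∂μ + 1 / ((m : ℝ) + 1) := by
    refine ae_all_iff.2 fun m => hT.ae_eventually_birkhoffAverage_lt hgm.neg hg.neg ?_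
    simp only [Pi.neg_apply, integral_neg]
    linarith [hpos m]
  filter_upwards [hup, hlow] with x h1 h2
  rw [Metric.tendsto_atTop']
  intro ε hε
  obtain ⟨m, hm⟩ := exists_nat_one_div_lt hε
  obtain ⟨N, hN⟩ := eventually_atTop.1 ((h1 m).and (h2 m))
  refine ⟨N, fun n hn => ?_⟩
  obtain ⟨ha, hb⟩ := hN n hn.le
  rw [birkhoffAverage_neg] at hb
  simp only [Pi.neg_apply] at hb
  rw [Real.dist_eq, abs_lt]
  constructor <;> linarith

end Birkhoff

/-! ### Frequencies of the configurations -/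

/-- The number of slots before `T` in which a sequence takes the value `σ`. -/
noncomputable def visitCount {Xi : Type*} (x : ℕ → Xi) (σ : Xi) (T : ℕ) : ℕ :=
  open Classical in ∑ t ∈ Finset.range T, if x t = σ then 1 else 0

/-- Almost surely, each configuration occurs with its stationary frequency. -/
theorem IsStationaryErgodic.ae_tendsto_visitCount {Xi Ω : Type*} [Finite Xi] [MeasurableSpace Xi]
    [MeasurableSingletonClass Xi] [MeasurableSpace Ω] {P : Measure Ω} [IsProbabilityMeasure P]
    {conf : ℕ → Ω → Xi} (hconf : IsStationaryErgodic P conf) :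
    ∀ᵐ ω ∂P, ∀ σ, Tendsto (fun T : ℕ => (visitCount (fun t => conf t ω) σ T : ℝ) / T) atTop
      (nhds (P.real {ω | conf 0 ω = σ})) := by
  classical
  rw [ae_all_iff]
  intro σ
  obtain ⟨hm, herg⟩ := hconf
  have hmeas : Measurable (fun ω t => conf t ω) := measurable_pi_lambda _ hm
  have : IsProbabilityMeasure (P.map fun ω t => conf t ω) :=
    Measure.isProbabilityMeasure_map hmeas.aemeasurable
  have hset : MeasurableSet {x : ℕ → Xi | x 0 = σ} :=
    measurableSet_eq_fun (measurable_pi_apply 0) measurable_const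
  have h := herg.ae_tendsto_birkhoffAverage (g := Set.indicator {x : ℕ → Xi | x 0 = σ} 1)
    (measurable_one.indicator hset) ((integrable_const (1 : ℝ)).indicator hset)
  filter_upwards [ae_of_ae_map hmeas.aemeasurable h] with ω hω
  rw [integral_indicator_one hset, map_measureReal_apply hmeas hset] at hω
  refine hω.congr fun n => ?_
  have hit : ∀ k, (fun (x : ℕ → Xi) (t : ℕ) => x (t + 1))^[k] (fun t => conf t ω)
      = fun t => conf (t + k) ω := by
    intro k
    induction k with
    | zero => rfl
    | succ k ih =>
      rw [Function.iterate_succ_apply', ih]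
      funext t
      exact congrArg (fun s => conf s ω) (Nat.add_right_comm t 1 k)
  simp only [birkhoffAverage, birkhoffSum, hit, smul_eq_mul, visitCount]
  rw [inv_mul_eq_div]
  push_cast
  congr 1
  refine Finset.sum_congr rfl fun k _ => ?_
  simp [Set.indicator_apply]

/-! ### Feasible schedules with prescribed averages -/

/-- Otherwise `M`, and hence its convex hull, would lie in an open half-space with `β` on its
boundary. With `y` an accumulated error, this supplies a next point that does not reinforce it. -/
theorem exists_mem_sum_mul_le_of_mem_convexHull {ι : Type*} [Fintype ι] {M : Set (ι → ℝ)}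
    {β : ι → ℝ} (hβ : β ∈ convexHull ℝ M) (y : ι → ℝ) :
    ∃ x ∈ M, ∑ e, y e * (x e - β e) ≤ 0 := by
  by_contra! h
  have hconv : Convex ℝ {x : ι → ℝ | ∑ e, y e * β e < ∑ e, y e * x e} := by
    refine convex_halfSpace_gt (f := fun x : ι → ℝ => ∑ e, y e * x e)
      ⟨fun a b => ?_, fun c a => ?_⟩ _
    · simp [mul_add, Finset.sum_add_distrib]
    · simp only [Pi.smul_apply, smul_eq_mul, Finset.mul_sum]
      exact Finset.sum_congr rfl fun e _ => by ring
  have hsub : M ⊆ {x : ι → ℝ | ∑ e, y e * β e < ∑ e, y e * x e} := fun x hx => by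
    have := h x hx
    simp only [mul_sub, Finset.sum_sub_distrib] at this
    exact sub_pos.1 this
  have hlt : ∑ e, y e * β e < ∑ e, y e * β e := convexHull_min hsub hconv hβ
  exact lt_irrefl _ hlt

theorem mem_Icc_of_mem_convexHull {ι : Type*} {M : Set (ι → ℝ)}
    (hM : ∀ x ∈ M, ∀ e, x e = 0 ∨ x e = 1) {β : ι → ℝ} (hβ : β ∈ convexHull ℝ M) :
    β ∈ Set.Icc (0 : ι → ℝ) 1 := by
  refine convexHull_min (fun x hx => ?_) (convex_Icc _ _) hβ
  constructor <;> intro e <;> rcases hM x hx e with h | h <;> simp [h]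

/-- A point of the convex hull is the limit of the running averages of a sequence of points of the
set, with error `O(n^(-1/2))`. -/
theorem exists_seq_sum_sub_sq_le {ι : Type*} [Fintype ι] {M : Set (ι → ℝ)}
    (hM : ∀ x ∈ M, ∀ e, x e = 0 ∨ x e = 1) {β : ι → ℝ} (hβ : β ∈ convexHull ℝ M) :
    ∃ x : ℕ → ι → ℝ, (∀ k, x k ∈ M) ∧
      ∀ n : ℕ, ∀ e, (∑ k ∈ Finset.range n, x k e - n * β e) ^ 2 ≤ n * Fintype.card ι := by
  choose g hgM hg using exists_mem_sum_mul_le_of_mem_convexHull hβ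
  have hβI := mem_Icc_of_mem_convexHull hM hβ
  -- `y n` is the accumulated error. The choice of `g` makes the cross term in `|y + (g y - β)|²`
  -- nonpositive, so each step adds at most `card ι` to the squared norm.
  let y : ℕ → ι → ℝ := fun n => Nat.rec 0 (fun _ z => z + (g z - β)) n
  have hy : ∀ n, y (n + 1) = y n + (g (y n) - β) := fun n => rfl
  have hsum : ∀ n e, ∑ k ∈ Finset.range n, g (y k) e - n * β e = y n e := by
    intro n e
    induction n with
    | zero => simp [y]
    | succ n ih =>
      rw [Finset.sum_range_succ, hy]
      simp only [Pi.add_apply, Pi.sub_apply, ← ih]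
      push_cast
      ring
  have hsq : ∀ n : ℕ, ∑ e, y n e ^ 2 ≤ n * Fintype.card ι := by
    intro n
    induction n with
    | zero => simp [y]
    | succ n ih =>
      have h1 : ∑ e, y (n + 1) e ^ 2 = ∑ e, y n e ^ 2
          + 2 * ∑ e, y n e * (g (y n) e - β e) + ∑ e, (g (y n) e - β e) ^ 2 := by
        rw [Finset.mul_sum, ← Finset.sum_add_distrib, ← Finset.sum_add_distrib]
        refine Finset.sum_congr rfl fun e _ => ?_
        rw [hy]
        simp only [Pi.add_apply, Pi.sub_apply]
        ring
      have h2 : ∑ e, (g (y n) e - β e) ^ 2 ≤ ∑ _e : ι, (1 : ℝ) := by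
        refine Finset.sum_le_sum fun e _ => ?_
        have h0 : 0 ≤ β e := hβI.1 e
        have h1 : β e ≤ 1 := hβI.2 e
        rcases hM _ (hgM (y n)) e with h | h <;> rw [h] <;> nlinarith
      rw [Finset.sum_const, Finset.card_univ, nsmul_eq_mul, mul_one] at h2
      have h3 := hg (y n)
      rw [h1]
      push_cast
      linarith
  refine ⟨fun k => g (y k), fun k => hgM _, fun n e => ?_⟩
  rw [hsum]
  exact (Finset.single_le_sum (f := fun e => y n e ^ 2) (fun _ _ => sq_nonneg _)
    (Finset.mem_univ e)).trans (hsq n)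

theorem visitCount_succ {Xi : Type*} [DecidableEq Xi] (x : ℕ → Xi) (σ : Xi) (T : ℕ) :
    visitCount x σ (T + 1) = visitCount x σ T + if x T = σ then 1 else 0 := by
  unfold visitCount
  rw [Finset.sum_range_succ]
  congr 1
  split_ifs <;> rfl

theorem visitCount_le {Xi : Type*} (x : ℕ → Xi) (σ : Xi) (T : ℕ) : visitCount x σ T ≤ T := by
  classical
  induction T with
  | zero => simp [visitCount]
  | succ T ih =>
    rw [visitCount_succ]
    split_ifs <;> omega

/-- Splitting a sum over time according to the value of a sequence. -/
theorem sum_range_visitCount {Xi : Type*} [Fintype Xi] (x : ℕ → Xi) (f : Xi → ℕ → ℝ) (T : ℕ) :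
    ∑ t ∈ Finset.range T, f (x t) (visitCount x (x t) t)
      = ∑ σ, ∑ k ∈ Finset.range (visitCount x σ T), f σ k := by
  classical
  induction T with
  | zero => simp [visitCount]
  | succ T ih =>
    rw [Finset.sum_range_succ, ih]
    have : ∀ σ, ∑ k ∈ Finset.range (visitCount x σ (T + 1)), f σ k
        = ∑ k ∈ Finset.range (visitCount x σ T), f σ k
          + if x T = σ then f σ (visitCount x σ T) else 0 := by
      intro σ
      rw [visitCount_succ]
      split_ifs
      · rw [Finset.sum_range_succ]
      · simp
    simp [this, Finset.sum_add_distrib]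

/-- The visits to `σ` up to `T` contribute `visitCount * b σ` plus an error of size at most `√(T
D)`, which vanishes after division by `T`. -/
theorem tendsto_sum_range_visitCount_div {Xi : Type*} [Fintype Xi] {x : ℕ → Xi} {p : Xi → ℝ}
    (hp : ∀ σ, Tendsto (fun T : ℕ => (visitCount x σ T : ℝ) / T) atTop (nhds (p σ)))
    {f : Xi → ℕ → ℝ} {b : Xi → ℝ} {D : ℝ}
    (hf : ∀ σ n, (∑ k ∈ Finset.range n, f σ k - n * b σ) ^ 2 ≤ n * D) :
    Tendsto (fun T : ℕ => (∑ t ∈ Finset.range T, f (x t) (visitCount x (x t) t)) / T) atTop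
      (nhds (∑ σ, p σ * b σ)) := by
  simp_rw [sum_range_visitCount]
  simp_rw [Finset.sum_div (s := (Finset.univ : Finset Xi))]
  refine tendsto_finsetSum _ fun σ _ => ?_
  have hD : 0 ≤ D := by
    have := (sq_nonneg _).trans (hf σ 1)
    simpa using this
  have herr : Tendsto (fun T : ℕ => (∑ k ∈ Finset.range (visitCount x σ T), f σ k
      - visitCount x σ T * b σ) / T) atTop (nhds 0) := by
    have hlim : Tendsto (fun T : ℕ => Real.sqrt (D / T)) atTop (nhds 0) := by
      have := (Real.continuous_sqrt.tendsto 0).comp (tendsto_const_div_atTop_nhds_zero_nat D)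
      rwa [Real.sqrt_zero] at this
    refine squeeze_zero_norm (fun T => ?_) hlim
    rw [Real.norm_eq_abs]
    refine Real.abs_le_sqrt ?_
    rcases Nat.eq_zero_or_pos T with rfl | hT
    · simp
    · have hT' : (0 : ℝ) < T := by exact_mod_cast hT
      rw [div_pow, div_le_div_iff₀ (by positivity) hT']
      have h1 := hf σ (visitCount x σ T)
      have h2 : (visitCount x σ T : ℝ) ≤ T := by exact_mod_cast visitCount_le x σ T
      have h3 := h1.trans (mul_le_mul_of_nonneg_right h2 hD)
      nlinarith
  have := herr.add ((hp σ).mul_const (b σ))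
  rw [zero_add] at this
  refine this.congr fun T => ?_
  ring

/-! ### Throughput of a queue -/

/-- An additive constant makes an eventual bound valid at all times, as induction over the slots
requires. -/
theorem exists_forall_ge_sub_of_eventually {u v : ℕ → ℝ} (h : ∀ᶠ t in atTop, u t ≤ v t) :
    ∃ K, 0 ≤ K ∧ ∀ t, u t - K ≤ v t := by
  obtain ⟨N, hN⟩ := eventually_atTop.1 h
  refine ⟨∑ s ∈ Finset.range N, |u s - v s|, Finset.sum_nonneg fun _ _ => abs_nonneg _,
    fun t => ?_⟩
  rcases lt_or_ge t N with ht | ht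
  · have := Finset.single_le_sum (f := fun s => |u s - v s|) (fun _ _ => abs_nonneg _)
      (Finset.mem_range.2 ht)
    have := le_abs_self (u t - v t)
    linarith
  · have := hN t ht
    have : 0 ≤ ∑ s ∈ Finset.range N, |u s - v s| := Finset.sum_nonneg fun _ _ => abs_nonneg _
    linarith [hN t ht]

/-- The throughput of a queue: `X` follows its targets `Q i` as fast as the service allows. If the
targets grow at rate at least `q` and the service rate is at least `q`, so does `X`. -/
theorem eventually_rate_le_of_service {ι : Type*} [Finite ι] {X a : ℕ → ℝ} {Q : ι → ℕ → ℝ}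
    {q b : ℝ} (hqb : q ≤ b) (hX0 : 0 ≤ X 0)
    (hX : ∀ t, X t + a t ≤ X (t + 1) ∨ ∃ i, Q i t ≤ X (t + 1))
    (ha : Tendsto (fun T : ℕ => (∑ t ∈ Finset.range T, a t) / T) atTop (nhds b))
    (hQ : ∀ i, ∀ ε > 0, ∀ᶠ t : ℕ in atTop, (q - ε) * t ≤ Q i t) :
    ∀ ε > 0, ∀ᶠ t : ℕ in atTop, (q - ε) * t ≤ X t := by
  -- The bounds lose `3 * ε` in rate; the fourth quarter absorbs the additive constants.
  intro ε' hε'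
  set ε := ε' / 4 with hεdef
  have hε : 0 < ε := by positivity
  set S : ℕ → ℝ := fun T => ∑ t ∈ Finset.range T, a t with hS
  have hSb : ∀ᶠ T : ℕ in atTop, (b - ε) * T ≤ S T ∧ S T ≤ (b + ε) * T := by
    filter_upwards [ha.eventually_mem (Ioo_mem_nhds (by linarith : b - ε < b)
      (by linarith : b < b + ε)), eventually_gt_atTop 0] with T hT hT0
    have hT0' : (0 : ℝ) < T := by exact_mod_cast hT0
    exact ⟨((lt_div_iff₀ hT0').1 hT.1).le, ((div_lt_iff₀ hT0').1 hT.2).le⟩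
  obtain ⟨K1, hK1, h1⟩ := exists_forall_ge_sub_of_eventually (hSb.mono fun _ h => h.1)
  obtain ⟨K2, hK2, h2⟩ := exists_forall_ge_sub_of_eventually (hSb.mono fun _ h => h.2)
  choose K3 hK3 h3 using fun i => exists_forall_ge_sub_of_eventually (hQ i ε hε)
  cases nonempty_fintype ι
  set K := K2 + ∑ i, K3 i + |q| with hK
  have hK3' : 0 ≤ ∑ i, K3 i := Finset.sum_nonneg fun i _ => hK3 i
  -- A full-service slot does not decrease `X - S`, while the lower bound falls since `q ≤ b`. When
  -- a target is reached, the bounds on `Q i` and `S` apply directly; `|q|` in `K` pays for the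
  -- one-slot delay.
  have key : ∀ t : ℕ, -(b - q + 2 * ε) * t - K ≤ X t - S t := by
    intro t
    induction t with
    | zero =>
      have := abs_nonneg q
      simp only [hS, Finset.range_zero, Finset.sum_empty, Nat.cast_zero, mul_zero]
      linarith
    | succ t ih =>
      have hSs : S (t + 1) = S t + a t := Finset.sum_range_succ _ _
      rcases hX t with h | ⟨i, hi⟩
      · push_cast
        nlinarith
      · have hb := h2 (t + 1)
        have hc := h3 i t
        have hd := Finset.single_le_sum (f := K3) (fun i _ => hK3 i) (Finset.mem_univ i)
        have := le_abs_self q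
        push_cast at hb ⊢
        nlinarith
  obtain ⟨m, hm⟩ := exists_nat_gt ((K1 + K) / ε)
  filter_upwards [eventually_ge_atTop m] with t ht
  have hmt : (m : ℝ) ≤ t := by exact_mod_cast ht
  have h4 : K1 + K < t * ε := (div_lt_iff₀ hε).1 (hm.trans_le hmt)
  have h5 := h1 t
  have h6 := key t
  have h7 : ε' = 4 * ε := by rw [hεdef]; ring
  rw [h7]
  nlinarith

theorem exists_partialSum_interval (g : ℕ → ℕ) (hg : g 0 = 0) {m k : ℕ} (hk : k < g m) :
    ∃ i < m, g i ≤ k ∧ k < g (i + 1) := by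
  classical
  have hex : ∃ m, k < g m := ⟨m, hk⟩
  obtain ⟨i, hi⟩ : ∃ i, Nat.find hex = i + 1 := by
    refine Nat.exists_eq_succ_of_ne_zero fun h => ?_
    have := Nat.find_spec hex
    rw [h, hg] at this
    omega
  refine ⟨i, ?_, ?_, ?_⟩
  · have := Nat.find_min' hex hk
    omega
  · exact not_lt.1 (Nat.find_min hex (by omega))
  · rw [← hi]
    exact Nat.find_spec hex

/-! ### In-order delivery on an acyclic graph -/

namespace WirelessNetwork

section Deterministic

variable {V Xi : Type*} {N : WirelessNetwork V Xi}

/-- Finiteness turns acyclicity into induction along the links, and into minimal nodes outside a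
cut. -/
theorem IsDAG.wellFounded [Finite V] (hN : N.IsDAG) : WellFounded fun i j => (i, j) ∈ N.E := by
  have : Std.Irrefl (Relation.TransGen fun i j => (i, j) ∈ N.E) := ⟨hN⟩
  have h := Finite.wellFounded_of_trans_of_irrefl (Relation.TransGen fun i j => (i, j) ∈ N.E)
  exact Subrelation.wf (fun h => Relation.TransGen.single h) h

theorem IsDAG.fst_ne_snd (hN : N.IsDAG) (e : N.E) : e.1.1 ≠ e.1.2 := fun h =>
  hN e.1.1 (Relation.TransGen.single (by
    have := e.2
    rwa [show (e.1.1, e.1.1) = e.1 from Prod.ext rfl h]))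

variable [DecidableEq V] (N)

/-- The links into a node. -/
def inLinks (j : V) : Finset N.E := Finset.univ.filter fun e : N.E => e.1.2 = j

variable {N} in
theorem mem_inLinks {j : V} {e : N.E} : e ∈ N.inLinks j ↔ e.1.2 = j := by
  simp [inLinks]

variable {N} in
theorem IsDAG.nodeCutVector_dotProduct [Fintype V] (hN : N.IsDAG) (j : V) (y : N.E → ℝ) :
    N.nodeCutVector j ⬝ᵥ y = ∑ e ∈ N.inLinks j, N.c e * y e := by
  rw [inLinks, Finset.sum_filter]
  refine Finset.sum_congr rfl fun e _ => ?_
  have := hN.fst_ne_snd e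
  by_cases h : e.1.2 = j
  · have h' : e.1.1 ≠ j := fun h' => this (h'.trans h.symm)
    simp [nodeCutVector, cutVector, h, h']
  · simp [nodeCutVector, cutVector, h]

theorem held_subset_range {a : ℕ → ℕ} {f : ℕ → N.E → Finset ℕ}
    (hf : ∀ t (e : N.E), f t e ⊆ N.held a f t e.1.1) (t : ℕ) (i : V) :
    N.held a f t i ⊆ Finset.range (∑ s ∈ Finset.range t, a s) := by
  induction t generalizing i with
  | zero => simp [held]
  | succ t ih =>
    have hmono : Finset.range (∑ s ∈ Finset.range t, a s)
        ⊆ Finset.range (∑ s ∈ Finset.range (t + 1), a s) :=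
      Finset.range_subset_range.2 (by rw [Finset.sum_range_succ]; omega)
    rw [held]
    refine Finset.union_subset (Finset.union_subset ((ih i).trans hmono) ?_) ?_
    · split_ifs
      · exact subset_rfl
      · exact Finset.empty_subset _
    · exact Finset.biUnion_subset.2 fun e _ => ((hf t e).trans (ih _)).trans hmono

theorem held_source {a : ℕ → ℕ} {f : ℕ → N.E → Finset ℕ}
    (hf : ∀ t (e : N.E), f t e ⊆ N.held a f t e.1.1) (t : ℕ) :
    N.held a f t N.source = Finset.range (∑ s ∈ Finset.range t, a s) := by
  refine (N.held_subset_range hf t _).antisymm ?_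
  cases t with
  | zero => simp
  | succ t =>
    rw [held, if_pos rfl]
    exact Finset.subset_union_right.trans Finset.subset_union_left

theorem card_held_le {a : ℕ → ℕ} {f : ℕ → N.E → Finset ℕ} {j : V} (hj : j ≠ N.source) (T : ℕ) :
    (N.held a f T j).card ≤ ∑ t ∈ Finset.range T, ∑ e ∈ N.inLinks j, (f t e).card := by
  induction T with
  | zero => simp [held]
  | succ T ih =>
    rw [held, if_neg hj, Finset.union_empty, Finset.sum_range_succ]
    exact (Finset.card_union_le _ _).trans (add_le_add ih Finset.card_biUnion_le)

/-- The number of packets that a node has received at the beginning of a slot under in-order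
delivery, when the link `e` can carry `n t e` packets in slot `t`: a node accepts a packet only
after all earlier packets, and only once all its in-neighbors have it. -/
def inOrder (a : ℕ → ℕ) (n : ℕ → N.E → ℕ) : ℕ → V → ℕ
  | 0, _ => 0
  | t + 1, j =>
    open Classical in if j = N.source then ∑ s ∈ Finset.range (t + 1), a s
    else (N.inLinks j).fold min (inOrder a n t j + ∑ e ∈ N.inLinks j, n t e)
      fun e => inOrder a n t e.1.1

/-- The total capacity in slot `t` of the links with the same head as `e` whose position in a fixed
enumeration is below `m`. -/
noncomputable def capacityBelow (n : ℕ → N.E → ℕ) (t : ℕ) (j : V) (m : ℕ) : ℕ :=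
  ∑ e ∈ (N.inLinks j).filter fun e => (Fintype.equivFin N.E e : ℕ) < m, n t e

/-- The packets sent over a link under in-order delivery: the links into a node share the next
packets among them. -/
noncomputable def inOrderFwd (a : ℕ → ℕ) (n : ℕ → N.E → ℕ) (t : ℕ) (e : N.E) : Finset ℕ :=
  Finset.Ico (N.inOrder a n t e.1.2 + N.capacityBelow n t e.1.2 (Fintype.equivFin N.E e))
    (min (N.inOrder a n t e.1.2 + N.capacityBelow n t e.1.2 (Fintype.equivFin N.E e) + n t e)
      (N.inOrder a n t e.1.1))

theorem card_inOrderFwd_le (a : ℕ → ℕ) (n : ℕ → N.E → ℕ) (t : ℕ) (e : N.E) :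
    (N.inOrderFwd a n t e).card ≤ n t e := by
  rw [inOrderFwd, Nat.card_Ico]
  omega

/-- The links into `j` divide the offsets below their total capacity into consecutive blocks of
length `n t e`, so each new packet is assigned to a link. -/
theorem exists_link_of_lt_sum (n : ℕ → N.E → ℕ) (t : ℕ) (j : V) {k : ℕ}
    (hk : k < ∑ e ∈ N.inLinks j, n t e) :
    ∃ e ∈ N.inLinks j, N.capacityBelow n t j (Fintype.equivFin N.E e) ≤ k ∧
      k < N.capacityBelow n t j (Fintype.equivFin N.E e) + n t e := by
  have hlast : N.capacityBelow n t j (Fintype.card N.E) = ∑ e ∈ N.inLinks j, n t e := by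
    rw [capacityBelow, Finset.filter_true_of_mem fun e _ => (Fintype.equivFin N.E e).2]
  obtain ⟨i, him, hi1, hi2⟩ := exists_partialSum_interval (N.capacityBelow n t j)
    (by simp [capacityBelow]) (hlast ▸ hk)
  set e := (Fintype.equivFin N.E).symm ⟨i, him⟩ with he
  have hei : (Fintype.equivFin N.E e : ℕ) = i := by simp [he]
  have huniq : ∀ e' : N.E, (Fintype.equivFin N.E e' : ℕ) = i → e' = e := fun e' h => by
    apply (Fintype.equivFin N.E).injective
    exact Fin.ext (h.trans hei.symm)
  by_cases hej : e ∈ N.inLinks j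
  · refine ⟨e, hej, by rwa [hei], hi2.trans_le ?_⟩
    rw [hei, capacityBelow, capacityBelow]
    have hnot : e ∉ (N.inLinks j).filter fun e => (Fintype.equivFin N.E e : ℕ) < i := by
      simp [hei]
    rw [add_comm _ (n t e), ← Finset.sum_insert hnot]
    refine Finset.sum_le_sum_of_subset fun e' h => ?_
    rw [Finset.mem_filter] at h
    rcases Nat.lt_succ_iff_lt_or_eq.1 h.2 with h' | h'
    · exact Finset.mem_insert_of_mem (Finset.mem_filter.2 ⟨h.1, h'⟩)
    · exact Finset.mem_insert.2 (Or.inl (huniq e' h'))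
  -- An index of a link with another head contributes an empty block, so no offset falls there.
  · exfalso
    refine absurd (hi2.trans_le ?_) (not_lt.2 hi1)
    refine Finset.sum_le_sum_of_subset fun e' h => ?_
    rw [Finset.mem_filter] at h ⊢
    refine ⟨h.1, (Nat.lt_succ_iff_lt_or_eq.1 h.2).resolve_right fun h' => hej ?_⟩
    rw [← huniq e' h']
    exact h.1

/-- The counts are realized by actual packets: a newly counted packet lies in the block of some
incoming link, and the minimum in `inOrder` ensures that it is below the count of the tail, so
truncation does not remove it. -/
theorem range_inOrder_subset_held (a : ℕ → ℕ) (n : ℕ → N.E → ℕ) (t : ℕ) (i : V) :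
    Finset.range (N.inOrder a n t i) ⊆ N.held a (N.inOrderFwd a n) t i := by
  induction t generalizing i with
  | zero => simp [inOrder]
  | succ t ih =>
    intro k hk
    rw [held]
    rw [inOrder, Finset.mem_range] at hk
    by_cases hi : i = N.source
    · rw [if_pos hi] at hk
      rw [if_pos hi]
      exact Finset.mem_union_left _ (Finset.mem_union_right _ (Finset.mem_range.2 hk))
    · rw [if_neg hi, Finset.lt_fold_min] at hk
      by_cases hki : k < N.inOrder a n t i
      · exact Finset.mem_union_left _ (Finset.mem_union_left _ (ih i (Finset.mem_range.2 hki)))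
      · obtain ⟨e, he, h1, h2⟩ := N.exists_link_of_lt_sum n t i (k := k - N.inOrder a n t i)
          (by omega)
        refine Finset.mem_union_right _ (Finset.mem_biUnion.2 ⟨e, he, ?_⟩)
        have hek := hk.2 e he
        rw [mem_inLinks] at he
        rw [inOrderFwd, he, Finset.mem_Ico]
        omega

theorem inOrderFwd_subset_held (a : ℕ → ℕ) (n : ℕ → N.E → ℕ) (t : ℕ) (e : N.E) :
    N.inOrderFwd a n t e ⊆ N.held a (N.inOrderFwd a n) t e.1.1 := by
  refine subset_trans (fun k hk => ?_) (N.range_inOrder_subset_held a n t e.1.1)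
  rw [inOrderFwd, Finset.mem_Ico, lt_min_iff] at hk
  exact Finset.mem_range.2 hk.2.2

variable {N} in
/-- In-order delivery reaches every node at the arrival rate `lam` if every node other than the
source has incoming capacity at least `lam`. -/
theorem IsDAG.eventually_rate_le_inOrder [Finite V] (hN : N.IsDAG) {a : ℕ → ℕ}
    {n : ℕ → N.E → ℕ} {lam : ℝ} {b : V → ℝ}
    (ha : Tendsto (fun T : ℕ => (∑ t ∈ Finset.range T, (a t : ℝ)) / T) atTop (nhds lam))
    (hb : ∀ j, j ≠ N.source → Tendsto (fun T : ℕ => (∑ t ∈ Finset.range T,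
      ((∑ e ∈ N.inLinks j, n t e : ℕ) : ℝ)) / T) atTop (nhds (b j)))
    (hlam : ∀ j, j ≠ N.source → lam ≤ b j) (j : V) :
    ∀ ε > 0, ∀ᶠ t : ℕ in atTop, (lam - ε) * t ≤ N.inOrder a n t j := by
  induction j using hN.wellFounded.induction with
  | _ j ih =>
    by_cases hj : j = N.source
    · intro ε hε
      filter_upwards [ha.eventually (lt_mem_nhds (by linarith : lam - ε < lam)),
        eventually_gt_atTop 0] with t ht ht0
      have ht0' : (0 : ℝ) < t := by exact_mod_cast ht0
      obtain ⟨s, rfl⟩ := Nat.exists_eq_succ_of_ne_zero ht0.ne'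
      rw [inOrder, if_pos hj]
      push_cast
      exact_mod_cast ((lt_div_iff₀ ht0').1 ht).le
    -- The targets are the counts of the in-neighbors, which have rate `lam` by induction. With no
    -- in-neighbor, only the service branch remains.
    · refine eventually_rate_le_of_service
        (Q := fun (e : {e // e ∈ N.inLinks j}) t => (N.inOrder a n t e.1.1.1 : ℝ))
        (hlam j hj) (Nat.cast_nonneg _) (fun t => ?_) (hb j hj) fun e ε hε => ?_
      · rw [inOrder, if_neg hj]
        rcases (Finset.fold_min_le (s := N.inLinks j) (f := fun e => N.inOrder a n t e.1.1)
          (b := N.inOrder a n t j + ∑ e ∈ N.inLinks j, n t e) _).1 le_rfl with h | ⟨e, he, h⟩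
        · left
          exact_mod_cast h
        · right
          exact ⟨⟨e, he⟩, by exact_mod_cast h⟩
      · refine ih _ ?_ ε hε
        have h := e.2
        rw [mem_inLinks] at h
        exact (show (e.1.1.1, j) = e.1.1 from Prod.ext rfl h.symm) ▸ e.1.2

end Deterministic

/-! ### Measurability of the policy and achievability -/

section Random

variable {V Xi Ω : Type*} [DecidableEq V] [MeasurableSpace Ω] (N : WirelessNetwork V Xi)

theorem measurable_inOrder {a : ℕ → Ω → ℕ} {n : ℕ → Ω → N.E → ℕ} (ha : ∀ t, Measurable (a t))
    (hn : ∀ t e, Measurable fun ω => n t ω e) (t : ℕ) (j : V) :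
    Measurable fun ω => N.inOrder (fun s => a s ω) (fun s => n s ω) t j := by
  classical
  induction t generalizing j with
  | zero => exact measurable_const
  | succ t ih =>
    by_cases hj : j = N.source
    · simp only [inOrder, if_pos hj]
      exact Finset.measurable_fun_sum _ fun s _ => ha s
    · simp only [inOrder, if_neg hj]
      have hfold : ∀ (b : Ω → ℕ), Measurable b → ∀ s : Finset N.E, Measurable fun ω =>
          s.fold min (b ω) fun e => N.inOrder (fun s => a s ω) (fun s => n s ω) t e.1.1 := by
        intro b hb s
        induction s using Finset.induction_on with
        | empty => simpa using hb
        | insert e s hes hs =>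
          simp only [Finset.fold_insert hes]
          exact (ih _).min hs
      exact hfold _ ((ih j).add (Finset.measurable_fun_sum _ fun e _ => hn t e)) _

theorem measurableSet_mem_inOrderFwd {a : ℕ → Ω → ℕ} {n : ℕ → Ω → N.E → ℕ}
    (ha : ∀ t, Measurable (a t)) (hn : ∀ t e, Measurable fun ω => n t ω e) (t : ℕ) (e : N.E)
    (k : ℕ) : MeasurableSet {ω | k ∈ N.inOrderFwd (fun s => a s ω) (fun s => n s ω) t e} := by
  have hD := N.measurable_inOrder ha hn t
  have hc : Measurable fun ω => N.capacityBelow (fun s => n s ω) t e.1.2 (Fintype.equivFin N.E e) :=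
    Finset.measurable_fun_sum _ fun e _ => hn t e
  simp only [inOrderFwd, Finset.mem_Ico]
  exact (measurableSet_le ((hD _).add hc) measurable_const).inter
    (measurableSet_lt measurable_const ((((hD _).add hc).add (hn t e)).min (hD _)))

variable [MeasurableSpace Xi] [MeasurableSingletonClass Xi]

theorem measurable_visitCount_self [Countable Xi] {conf : ℕ → Ω → Xi}
    (hconf : ∀ t, Measurable (conf t)) (t : ℕ) :
    Measurable fun ω => visitCount (fun s => conf s ω) (conf t ω) t := by
  classical
  simp only [visitCount]
  refine Finset.measurable_fun_sum _ fun s _ => Measurable.ite ?_ measurable_const measurable_const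
  exact measurableSet_eq_fun (hconf s) (hconf t)

variable {N} {conf : ℕ → Ω → Xi} {A : ℕ → Ω → ℕ}

/-- The number of packets that each link can carry in a slot under a schedule in which the
`k`-th slot with configuration `σ` uses the activation `x σ k`. -/
noncomputable def slotCapacity (N : WirelessNetwork V Xi) (x : Xi → ℕ → N.E → ℝ)
    (conf : ℕ → Ω → Xi) (t : ℕ) (ω : Ω) (e : N.E) : ℕ :=
  if x (conf t ω) (visitCount (fun s => conf s ω) (conf t ω) t) e = 1 then N.c e else 0

/-- The policy that uses the activation `x σ k` in the `k`-th slot with configuration `σ`, with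
in-order delivery of the packets. -/
noncomputable def inOrderPolicy [Countable Xi] (x : Xi → ℕ → N.E → ℝ) (hx : ∀ σ k, x σ k ∈ N.M σ)
    (hconf : ∀ t, Measurable (conf t)) (hA : ∀ t, Measurable (A t)) : N.Policy conf A :=
  have hact : ∀ t, Measurable fun ω =>
      x (conf t ω) (visitCount (fun s => conf s ω) (conf t ω) t) := fun t =>
    (Measurable.of_discrete (f := fun p : Xi × ℕ => x p.1 p.2)).comp
      ((hconf t).prodMk (measurable_visitCount_self hconf t))
  have hn : ∀ t e, Measurable fun ω => N.slotCapacity x conf t ω e := fun t e =>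
    Measurable.ite (measurableSet_eq_fun ((measurable_pi_apply e).comp (hact t)) measurable_const)
      measurable_const measurable_const
  { act := fun t ω => x (conf t ω) (visitCount (fun s => conf s ω) (conf t ω) t)
    fwd := fun t ω => N.inOrderFwd (fun s => A s ω) (fun s => N.slotCapacity x conf s ω) t
    act_mem := fun _ _ => hx _ _
    fwd_held := fun t ω e => N.inOrderFwd_subset_held _ _ t e
    fwd_card := fun t ω e => by
      have h : ((N.inOrderFwd (fun s => A s ω) (fun s => N.slotCapacity x conf s ω) t e).card : ℝ)
          ≤ N.slotCapacity x conf t ω e := by exact_mod_cast N.card_inOrderFwd_le _ _ t e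
      refine h.trans ?_
      rcases N.M_binary _ _ (hx (conf t ω) (visitCount (fun s => conf s ω) (conf t ω) t)) e
        with h | h <;> simp [slotCapacity, h]
    act_measurable := hact
    fwd_measurable := fun t e k => N.measurableSet_mem_inOrderFwd hA hn t e k }

/-- If every single-node cut has average capacity at least `lam` under some stationary randomized
activation, then there is a broadcast policy of rate `lam`. -/
theorem IsDAG.exists_isBroadcastPolicy [Fintype V] [Fintype Xi] {P : Measure Ω}
    [IsProbabilityMeasure P] (hN : N.IsDAG) (hconf : IsStationaryErgodic P conf) {lam : ℝ}
    (hA : IsArrivalProcess P A lam) {β : Xi → N.E → ℝ} (hβ : ∀ σ, β σ ∈ convexHull ℝ (N.M σ))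
    (hlam : ∀ j, j ≠ N.source → lam ≤ N.nodeCutVector j ⬝ᵥ N.averageActivation P conf β) :
    ∃ π : N.Policy conf A, π.IsBroadcastPolicy P lam := by
  choose x hxM hx using fun σ => exists_seq_sum_sub_sq_le (N.M_binary σ) (hβ σ)
  obtain ⟨hAm, hAi, hAd, hAint, hAmean⟩ := hA
  set π := inOrderPolicy x hxM hconf.1 hAm
  refine ⟨π, ?_⟩
  have hslln := strong_law_ae_real (μ := P) (fun t ω => (A t ω : ℝ)) hAint
    (fun s t hst => (hAi.indepFun hst).comp (φ := fun k : ℕ => (k : ℝ)) (ψ := fun k : ℕ => (k : ℝ))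
      measurable_from_nat measurable_from_nat)
    (fun t => (hAd t).comp (u := fun k : ℕ => (k : ℝ)) measurable_from_nat)
  rw [hAmean] at hslln
  filter_upwards [hslln, hconf.ae_tendsto_visitCount] with ω hω hfreq
  have hcap : ∀ j, j ≠ N.source → Tendsto (fun T : ℕ => (∑ t ∈ Finset.range T,
      ((∑ e ∈ N.inLinks j, N.slotCapacity x conf t ω e : ℕ) : ℝ)) / T) atTop
      (nhds (N.nodeCutVector j ⬝ᵥ N.averageActivation P conf β)) := by
    intro j _
    rw [hN.nodeCutVector_dotProduct]
    have hlim : ∀ e, Tendsto (fun T : ℕ => (∑ t ∈ Finset.range T,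
        x (conf t ω) (visitCount (fun s => conf s ω) (conf t ω) t) e) / T) atTop
        (nhds (N.averageActivation P conf β e)) := by
      intro e
      have := tendsto_sum_range_visitCount_div (f := fun σ k => x σ k e) (b := fun σ => β σ e)
        hfreq (fun σ n => hx σ n e)
      simpa [averageActivation, Finset.sum_apply] using this
    refine (tendsto_finsetSum (N.inLinks j) fun e _ => (hlim e).const_mul (N.c e : ℝ)).congr
      fun T => ?_
    have hcapR : ∀ t e, (N.slotCapacity x conf t ω e : ℝ)
        = N.c e * x (conf t ω) (visitCount (fun s => conf s ω) (conf t ω) t) e := by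
      intro t e
      rcases N.M_binary _ _ (hxM (conf t ω) (visitCount (fun s => conf s ω) (conf t ω) t)) e
        with h | h <;> simp [slotCapacity, h]
    simp only [Nat.cast_sum, hcapR]
    rw [Finset.sum_comm, Finset.sum_div]
    exact Finset.sum_congr rfl fun e _ => by rw [← Finset.mul_sum, mul_div_assoc]
  have hrate := hN.eventually_rate_le_inOrder hω hcap hlam
  -- The source holds exactly the arrived packets, so it caps the infimum at `lam`; in-order
  -- delivery gives the lower bound at every node.
  refine le_antisymm ((iInf_le _ N.source).trans (le_of_eq ?_)) (le_iInf fun i => ?_)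
  · refine Tendsto.liminf_eq ((continuous_coe_real_ereal.tendsto lam).comp (hω.congr fun T => ?_))
    rw [Policy.received, N.held_source (fun t e => π.fwd_held t ω e), Finset.card_range]
    push_cast
    rfl
  · refine le_of_forall_lt_imp_le_of_dense fun c hc => ?_
    obtain ⟨z, hcz, hz⟩ := EReal.lt_iff_exists_real_btwn.1 hc
    refine hcz.le.trans (le_liminf_of_le (by isBoundedDefault) ?_)
    filter_upwards [hrate i (lam - z) (sub_pos.2 (EReal.coe_lt_coe_iff.1 hz)),
      eventually_gt_atTop 0] with T hT hT0
    rw [sub_sub_cancel] at hT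
    rw [EReal.coe_le_coe_iff, le_div_iff₀ (by exact_mod_cast hT0)]
    refine hT.trans ?_
    have h := Finset.card_le_card (N.range_inOrder_subset_held (fun s => A s ω)
      (fun s => N.slotCapacity x conf s ω) T i)
    rw [Finset.card_range] at h
    exact_mod_cast h

end Random

end WirelessNetwork

/-! ### The cut bound -/

namespace WirelessNetwork

variable {V Xi Ω : Type*}

theorem finite_M (N : WirelessNetwork V Xi) (σ : Xi) : (N.M σ).Finite := by
  refine (Set.Finite.pi' (t := fun _ : N.E => ({0, 1} : Set ℝ)) fun _ => by simp).subset
    fun s hs e => ?_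
  simpa using N.M_binary σ s hs e

/-- The families of randomized activations. -/
def randomizedActivations (N : WirelessNetwork V Xi) : Set (Xi → N.E → ℝ) :=
  Set.univ.pi fun σ => convexHull ℝ (N.M σ)

theorem mem_randomizedActivations {N : WirelessNetwork V Xi} {β : Xi → N.E → ℝ} :
    β ∈ N.randomizedActivations ↔ ∀ σ, β σ ∈ convexHull ℝ (N.M σ) := by
  simp [randomizedActivations]

theorem isCompact_randomizedActivations (N : WirelessNetwork V Xi) :
    IsCompact N.randomizedActivations :=
  isCompact_univ_pi fun σ => (N.finite_M σ).isCompact_convexHull ℝ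

theorem randomizedActivations_nonempty (N : WirelessNetwork V Xi) :
    N.randomizedActivations.Nonempty :=
  Set.univ_pi_nonempty_iff.2 fun σ => (N.M_nonempty σ).convexHull

/-- A time average of activations is an average, over the configurations, of randomized
activations. -/
theorem exists_sum_eq_sum_visitCount_smul [Fintype Xi] (N : WirelessNetwork V Xi) {x : ℕ → Xi}
    {s : ℕ → N.E → ℝ} (hs : ∀ t, s t ∈ N.M (x t)) (T : ℕ) :
    ∃ β ∈ N.randomizedActivations,
      ∑ t ∈ Finset.range T, s t = ∑ σ, (visitCount x σ T : ℝ) • β σ := by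
  classical
  have hone : ∀ σ, ∃ β ∈ convexHull ℝ (N.M σ),
      ∑ t ∈ (Finset.range T).filter (fun t => x t = σ), s t = (visitCount x σ T : ℝ) • β := by
    intro σ
    have hcard : visitCount x σ T = ((Finset.range T).filter fun t => x t = σ).card := by
      rw [Finset.card_filter, visitCount]
    rcases Nat.eq_zero_or_pos (visitCount x σ T) with h0 | hpos
    -- An unvisited configuration has weight zero, so any feasible activation serves.
    · obtain ⟨m, hm⟩ := N.M_nonempty σ
      refine ⟨m, subset_convexHull ℝ _ hm, ?_⟩
      have hempty := Finset.card_eq_zero.1 (hcard ▸ h0)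
      simp [h0, hempty]
    · have hpos' : (0 : ℝ) < visitCount x σ T := by exact_mod_cast hpos
      refine ⟨∑ t ∈ (Finset.range T).filter (fun t => x t = σ), (visitCount x σ T : ℝ)⁻¹ • s t,
        (convex_convexHull ℝ _).sum_mem (fun _ _ => by positivity) ?_ fun t ht => ?_, ?_⟩
      · rw [Finset.sum_const, ← hcard, nsmul_eq_mul, mul_inv_cancel₀ hpos'.ne']
      · have := hs t
        rw [(Finset.mem_filter.1 ht).2] at this
        exact subset_convexHull ℝ _ this
      · rw [← Finset.smul_sum, smul_inv_smul₀ hpos'.ne']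
  choose β hβ hsum using hone
  refine ⟨β, mem_randomizedActivations.2 hβ, ?_⟩
  rw [← Finset.sum_fiberwise (Finset.range T) x s]
  exact Finset.sum_congr rfl fun σ _ => hsum σ

variable [MeasurableSpace Ω] {N : WirelessNetwork V Xi}

theorem continuous_averageActivation [Fintype Xi] (P : Measure Ω) (conf : ℕ → Ω → Xi) :
    Continuous (N.averageActivation P conf) := by
  unfold averageActivation
  fun_prop

theorem IsDAG.received_le [Fintype V] [DecidableEq V] (hN : N.IsDAG)
    {conf : ℕ → Ω → Xi} {A : ℕ → Ω → ℕ}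
    (π : N.Policy conf A) {j : V} (hj : j ≠ N.source) (T : ℕ) (ω : Ω) :
    (π.received T ω j : ℝ) ≤ N.nodeCutVector j ⬝ᵥ ∑ t ∈ Finset.range T, π.act t ω := by
  have h : (π.received T ω j : ℝ) ≤ ∑ t ∈ Finset.range T, ∑ e ∈ N.inLinks j,
      ((π.fwd t ω e).card : ℝ) := by
    exact_mod_cast N.card_held_le hj T
  refine h.trans ?_
  rw [dotProduct_sum]
  refine Finset.sum_le_sum fun t _ => ?_
  rw [hN.nodeCutVector_dotProduct]
  exact Finset.sum_le_sum fun e _ => π.fwd_card t ω e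

/-- The cut bound: a broadcast policy of rate `lam` gives a stationary randomized activation under
which every single-node cut has average capacity at least `lam`. -/
theorem IsDAG.exists_le_nodeCutVector_dotProduct [Fintype V] [DecidableEq V]
    [Fintype Xi] [MeasurableSpace Xi] [MeasurableSingletonClass Xi]
    {P : Measure Ω} [IsProbabilityMeasure P] (hN : N.IsDAG) {conf : ℕ → Ω → Xi}
    (hconf : IsStationaryErgodic P conf) {A : ℕ → Ω → ℕ} {lam : ℝ} {π : N.Policy conf A}
    (hπ : π.IsBroadcastPolicy P lam) :
    ∃ β ∈ N.randomizedActivations,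
      ∀ j, j ≠ N.source → lam ≤ N.nodeCutVector j ⬝ᵥ N.averageActivation P conf β := by
  -- The conclusion is deterministic, so one good sample path suffices.
  obtain ⟨ω, hω, hfreq⟩ := (hπ.and hconf.ae_tendsto_visitCount).exists
  choose β hβ hsum using N.exists_sum_eq_sum_visitCount_smul (fun t => π.act_mem t ω)
  obtain ⟨β', hβ', φ, hφ, hlim⟩ := N.isCompact_randomizedActivations.tendsto_subseq hβ
  refine ⟨β', hβ', fun j hj => ?_⟩
  have hbound : ∀ T : ℕ, (π.received T ω j : ℝ) / T ≤ N.nodeCutVector j ⬝ᵥ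
      ∑ σ, ((visitCount (fun t => conf t ω) σ T : ℝ) / T) • β T σ := by
    intro T
    have h := hN.received_le π hj T ω
    rw [hsum] at h
    have h' : N.nodeCutVector j ⬝ᵥ ∑ σ, ((visitCount (fun t => conf t ω) σ T : ℝ) / T) • β T σ
        = (N.nodeCutVector j ⬝ᵥ ∑ σ, (visitCount (fun t => conf t ω) σ T : ℝ) • β T σ) / T := by
      simp_rw [div_eq_inv_mul, mul_smul, ← Finset.smul_sum, dotProduct_smul, smul_eq_mul]
    rw [h']
    exact div_le_div_of_nonneg_right h (Nat.cast_nonneg T)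
  have hconv : Tendsto (fun k => N.nodeCutVector j ⬝ᵥ
      ∑ σ, ((visitCount (fun t => conf t ω) σ (φ k) : ℝ) / (φ k : ℕ)) • β (φ k) σ) atTop
      (nhds (N.nodeCutVector j ⬝ᵥ N.averageActivation P conf β')) := by
    have h1 : Tendsto (fun k => ∑ σ, ((visitCount (fun t => conf t ω) σ (φ k) : ℝ) / (φ k : ℕ))
        • β (φ k) σ) atTop (nhds (N.averageActivation P conf β')) :=
      tendsto_finsetSum _ fun σ _ =>
        ((hfreq σ).comp hφ.tendsto_atTop).smul ((tendsto_pi_nhds.1 hlim) σ)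
    have hc : Continuous fun y : N.E → ℝ => N.nodeCutVector j ⬝ᵥ y :=
      continuous_const.dotProduct continuous_id
    exact (hc.tendsto _).comp h1
  -- A lower bound on the `liminf` holds for all large `T`, hence along the subsequence chosen by
  -- compactness.
  refine le_of_forall_lt_imp_le_of_dense fun z hz => ?_
  have hev : ∀ᶠ T : ℕ in atTop, (z : EReal) < (((π.received T ω j : ℝ) / (T : ℝ) : ℝ) : EReal) := by
    exact eventually_lt_of_lt_liminf
      ((EReal.coe_lt_coe_iff.2 hz).trans_le (hω.symm.le.trans (iInf_le _ j)))
  refine ge_of_tendsto hconv ?_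
  filter_upwards [hφ.tendsto_atTop.eventually hev] with k hk
  exact (EReal.coe_lt_coe_iff.1 hk).le.trans (hbound _)

theorem nonneg_of_mem_randomizedActivations [Fintype Xi] {β : Xi → N.E → ℝ}
    (hβ : β ∈ N.randomizedActivations)
    (P : Measure Ω) (conf : ℕ → Ω → Xi) (e : N.E) : 0 ≤ N.averageActivation P conf β e := by
  simp only [averageActivation, Finset.sum_apply, Pi.smul_apply, smul_eq_mul]
  exact Finset.sum_nonneg fun σ _ => mul_nonneg measureReal_nonneg
    ((mem_Icc_of_mem_convexHull (N.M_binary σ) (mem_randomizedActivations.1 hβ σ)).1 e)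

theorem cutVector_dotProduct_nonneg [DecidableEq V] (U : Finset V) {y : N.E → ℝ}
    (hy : ∀ e, 0 ≤ y e) : 0 ≤ N.cutVector U ⬝ᵥ y := by
  refine Finset.sum_nonneg fun e _ => mul_nonneg ?_ (hy e)
  rw [cutVector]
  split_ifs
  · exact Nat.cast_nonneg _
  · exact le_rfl

/-! ### Proper cuts, single-node cuts and the maximum -/

variable [Fintype V] [DecidableEq V]

/-- In a directed acyclic graph every proper cut dominates a single-node cut. -/
theorem IsDAG.exists_nodeCutVector_dotProduct_le (hN : N.IsDAG) {U : Finset V}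
    (hU : N.IsProperCut U) {y : N.E → ℝ} (hy : ∀ e, 0 ≤ y e) :
    ∃ j, j ≠ N.source ∧ N.nodeCutVector j ⬝ᵥ y ≤ N.cutVector U ⬝ᵥ y := by
  obtain ⟨hsrc, hne⟩ := hU
  obtain ⟨v, hv⟩ : ∃ v, v ∉ U := by
    by_contra! h
    exact hne (Finset.eq_univ_iff_forall.2 h)
  -- By minimality every link into `j` starts in `U`, so `u_j ≤ u_U` entrywise.
  obtain ⟨j, hj, hmin⟩ := hN.wellFounded.has_min {v | v ∉ U} ⟨v, hv⟩
  refine ⟨j, fun h => hj (h ▸ hsrc), ?_⟩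
  refine Finset.sum_le_sum fun e _ => mul_le_mul_of_nonneg_right ?_ (hy e)
  unfold nodeCutVector cutVector
  by_cases hej : e.1.2 = j
  · have h1 : e.1.1 ∈ U := by
      by_contra h
      exact hmin e.1.1 h (by rw [← hej]; exact e.2)
    have h2 : e.1.2 ∉ U := by rw [hej]; exact hj
    rw [if_pos (And.intro h1 h2)]
    split_ifs
    · exact le_rfl
    · exact Nat.cast_nonneg _
  · rw [if_neg (by simp [hej])]
    split_ifs
    · exact Nat.cast_nonneg _
    · exact le_rfl

theorem isProperCut_erase {j : V} (hj : j ≠ N.source) : N.IsProperCut (Finset.univ.erase j) :=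
  ⟨Finset.mem_erase.2 ⟨hj.symm, Finset.mem_univ _⟩, fun h => by
    have := Finset.mem_univ j
    rw [← h] at this
    exact Finset.notMem_erase j _ this⟩

instance nonempty_ne_source [Nontrivial V] (N : WirelessNetwork V Xi) :
    Nonempty {j : V // j ≠ N.source} :=
  (exists_ne N.source).elim fun j hj => ⟨⟨j, hj⟩⟩

instance nonempty_isProperCut [Nontrivial V] (N : WirelessNetwork V Xi) :
    Nonempty {U : Finset V // N.IsProperCut U} :=
  (exists_ne N.source).elim fun _ hj => ⟨⟨_, isProperCut_erase hj⟩⟩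

theorem IsDAG.iInf_cutVector_eq [Nontrivial V] (hN : N.IsDAG) {y : N.E → ℝ} (hy : ∀ e, 0 ≤ y e) :
    ⨅ U : {U : Finset V // N.IsProperCut U}, N.cutVector U ⬝ᵥ y
      = ⨅ j : {j : V // j ≠ N.source}, N.nodeCutVector j ⬝ᵥ y := by
  refine le_antisymm (le_ciInf fun j => ?_) (le_ciInf fun U => ?_)
  · exact ciInf_le (Set.finite_range _).bddBelow
      (⟨_, isProperCut_erase j.2⟩ : {U : Finset V // N.IsProperCut U})
  · obtain ⟨j, hj, hle⟩ := hN.exists_nodeCutVector_dotProduct_le U.2 hy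
    exact (ciInf_le (Set.finite_range _).bddBelow
      (⟨j, hj⟩ : {j : V // j ≠ N.source})).trans hle

/-- A minimum of finitely many continuous functions attains its maximum on the compact set of
randomized activations. -/
theorem exists_isGreatest_nodeCut [Nontrivial V] [Fintype Xi] (P : Measure Ω) (conf : ℕ → Ω → Xi) :
    ∃ C, IsGreatest {x : ℝ | ∃ β : Xi → N.E → ℝ, (∀ σ, β σ ∈ convexHull ℝ (N.M σ)) ∧
        x = ⨅ j : {j : V // j ≠ N.source},
          N.nodeCutVector j ⬝ᵥ N.averageActivation P conf β} C := by
  have hcont : Continuous fun β : Xi → N.E → ℝ => ⨅ j : {j : V // j ≠ N.source},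
      N.nodeCutVector j ⬝ᵥ N.averageActivation P conf β := by
    simp_rw [← Finset.inf'_univ_eq_ciInf]
    exact Continuous.finset_inf'_apply _ fun j _ =>
      continuous_const.dotProduct (continuous_averageActivation P conf)
  obtain ⟨β, hβ, hmax⟩ := N.isCompact_randomizedActivations.exists_isMaxOn
    N.randomizedActivations_nonempty hcont.continuousOn
  refine ⟨_, ⟨β, mem_randomizedActivations.1 hβ, rfl⟩, ?_⟩
  rintro _ ⟨β', hβ', rfl⟩
  exact hmax (mem_randomizedActivations.2 hβ')

end WirelessNetwork

theorem theorem1 {V Xi Ω : Type*} [Fintype V] [DecidableEq V] [Nontrivial V]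
    [Fintype Xi] [MeasurableSpace Xi] [MeasurableSingletonClass Xi]
    [MeasurableSpace Ω] (P : Measure Ω) [IsProbabilityMeasure P]
    (N : WirelessNetwork V Xi) (hN : N.IsDAG)
    (conf : ℕ → Ω → Xi) (hconf : IsStationaryErgodic P conf)
    (A : ℝ → ℕ → Ω → ℕ) (hA : ∀ lam, 0 ≤ lam → IsArrivalProcess P (A lam) lam) :
    ∃ C : ℝ, N.IsBroadcastCapacity P conf A C ∧
      IsGreatest {x : ℝ | ∃ β : Xi → N.E → ℝ, (∀ σ, β σ ∈ convexHull ℝ (N.M σ)) ∧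
        x = ⨅ j : {j : V // j ≠ N.source},
          N.nodeCutVector j ⬝ᵥ N.averageActivation P conf β} C ∧
      IsGreatest {x : ℝ | ∃ β : Xi → N.E → ℝ, (∀ σ, β σ ∈ convexHull ℝ (N.M σ)) ∧
        x = ⨅ U : {U : Finset V // N.IsProperCut U},
          N.cutVector U ⬝ᵥ N.averageActivation P conf β} C := by
  obtain ⟨C, hC⟩ := WirelessNetwork.exists_isGreatest_nodeCut (N := N) P conf
  have hnn : ∀ β : Xi → N.E → ℝ, (∀ σ, β σ ∈ convexHull ℝ (N.M σ)) →
      ∀ e, 0 ≤ N.averageActivation P conf β e := fun β hβ =>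
    WirelessNetwork.nonneg_of_mem_randomizedActivations
      (WirelessNetwork.mem_randomizedActivations.2 hβ) P conf
  -- The supremum is attained: `C` is itself a broadcast rate.
  refine ⟨C, IsGreatest.isLUB ⟨?_, ?_⟩, hC, ?_⟩
  · obtain ⟨β, hβ, hCβ⟩ := hC.1
    have hC0 : 0 ≤ C := by
      rw [hCβ]
      exact le_ciInf fun j => WirelessNetwork.cutVector_dotProduct_nonneg _ (hnn β hβ)
    refine ⟨hC0, hN.exists_isBroadcastPolicy hconf (hA C hC0) hβ fun j hj => ?_⟩
    rw [hCβ]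
    exact ciInf_le (f := fun j : {j : V // j ≠ N.source} =>
      N.nodeCutVector j ⬝ᵥ N.averageActivation P conf β) (Set.finite_range _).bddBelow
      (⟨j, hj⟩ : {j : V // j ≠ N.source})
  · rintro lam ⟨-, π, hπ⟩
    obtain ⟨β, hβ, hle⟩ := hN.exists_le_nodeCutVector_dotProduct hconf hπ
    have hmem : (⨅ j : {j : V // j ≠ N.source},
        N.nodeCutVector j ⬝ᵥ N.averageActivation P conf β) ≤ C :=
      hC.2 ⟨β, WirelessNetwork.mem_randomizedActivations.1 hβ, rfl⟩
    have hinf : lam ≤ ⨅ j : {j : V // j ≠ N.source},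
        N.nodeCutVector j ⬝ᵥ N.averageActivation P conf β := le_ciInf fun j => hle j.1 j.2
    exact hinf.trans hmem
  · convert hC using 1
    ext x
    refine exists_congr fun β => and_congr_right fun hβ => ?_
    rw [hN.iInf_cutVector_eq (hnn β hβ)]
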